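/- **Theorem (Nonlinear systems on unbounded space).** Let $M<N$, $0<p<1$, and let $X\subseteq\mathbb R^N$ be a possibly unbounded set contained in the closure of its interior, with $0\in X$. Consider the system $$x_{t+1}=f(x_t),\qquad y_t=\xi_t\,h(x_t),$$ where $f$ maps $X$ into $X$, $h$ maps $X$ into $Y\subseteq\mathbb R^M$, and the $\xi_t$ are i.i.d. random variables with values in $\{0,1\}$ and $\mathrm{Prob}(\xi_t=1)=p$. Assume, for some $r\ge 1$: 1. $f$ and $h$ are $C^r$ at (that is, near) every point of $X$, $f(0)=0$, $h(0)=0$, and the Jacobian $A(x)=\frac{\partial f}{\partial x}(x)$ is uniformly bounded above and below: $aI_N\le A(x)'A(x)\le bI_N$ for all $x\in X$, with constants $a,b>0$. 2. The map $\theta^{N-1}(x)=(h(x),h(f(x)),\dots,h(f^{N-1}(x)))'$ satisfies $\operatorname{rank}\frac{\partial\theta^{N-1}}{\partial x}(x)=N$ and $\alpha_\theta I_N<\frac{\partial\theta^{N-1}}{\partial x}(x)'\,\frac{\partial\theta^{N-1}}{\partial x}(x)<\beta_\theta I_N$ for all $x\in X$, with constants $\alpha_\theta,\beta_\theta>0$.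 3. The output Jacobian $C(x)=\frac{\partial h}{\partial x}(x)$ has uniformly full row rank: $C(x)C(x)'\ge\delta I_M$ for all $x\in X$, with a constant $\delta>0$. Consider the observer $$\hat x_{t+1}=f(\hat x_t)+K(y_t)-K(\hat y_t),\qquad \hat y_t=\xi_t h(\hat x_t),$$ with a deterministic gain $K$ that takes values in $\mathbb R^N$, is $C^r$ at (near) every point of $Y$, satisfies $K(0)=0$, and keeps the observer state in $X$. Suppose that the error $e_t=x_t-\hat x_t$ is mean-square exponentially stable: there are constants $0<L<\infty$ and $0<\beta<1$ such that for Lebesgue almost all $x_0\in X$ and Lebesgue almost all $\hat x_0\in X$, $$E_{\xi_0^t}\big[\|e_{t+1}\|^2\big]\le L\beta^t\|e_0\|^2\qquad\text{for all }t\ge 0 .$$ Then there are a function $Q_0$ from $X$ to the symmetric $N\times N$ matrices, uniformly bounded above and below ($\gamma_1 I_N\le Q_0(x)\le\gamma_2 I_N$ for all $x\in X$, with constants $\gamma_1,\gamma_2>0$), and a function $R$ from $X$ to the symmetric positive semidefinite $N\times N$ matrices such that for all $x\in X$ $$Q_0(f(x))=A(x)Q_0(x)A(x)'+R(x)-A(x)Q_0(x)C(x)'\big(I_M+C(x)Q_0(x)C(x)'\big)^{-1}C(x)Q_0(x)A(x)',$$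 and for Lebesgue almost all $x\in X$ $$(1-p)^M\,\big(\det A(x)\big)^2\,\frac{\det Q_0(x)}{\det Q_0(f(x))}<1 .$$ -/

import Mathlib

open MeasureTheory ProbabilityTheory Matrix

namespace ErasureObserver

/-- `ℝⁿ` with its Euclidean norm. -/
abbrev E (n : ℕ) : Type := EuclideanSpace ℝ (Fin n)

/-- The Jacobian matrix `∂F/∂x (x)`: its `(i, j)` entry is `∂Fᵢ/∂xⱼ (x)`. -/
noncomputable def jac {ι κ : Type*} [Fintype ι] [DecidableEq ι] [Fintype κ]
    (F : EuclideanSpace ℝ ι → EuclideanSpace ℝ κ) (x : EuclideanSpace ℝ ι) : Matrix κ ι ℝ :=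
  Matrix.of fun i j => (fderiv ℝ F x (EuclideanSpace.single j 1)) i

/-- The observability map `θ(x) = (h(x), h(f(x)), …, h(f^{N-1}(x)))`. -/
noncomputable def obsMap {N M : ℕ} (f : E N → E N) (h : E N → E M) (x : E N) :
    EuclideanSpace ℝ (Fin N × Fin M) :=
  WithLp.toLp 2 fun ki => h (f^[(ki.1 : ℕ)] x) ki.2

/-- The regularity and observability assumption on the plant `x_{t+1} = f(x_t)` with output map
`h` and state space `X`. Strict matrix inequalities `S < T` mean that `T - S` is positive
definite. -/
structure IsRegularObservable {N M : ℕ} (r : WithTop ℕ∞) (X : Set (E N))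
    (f : E N → E N) (h : E N → E M) : Prop where
  zero_mem : (0 : E N) ∈ X
  mapsTo : Set.MapsTo f X X
  contDiff_f : ∀ x ∈ X, ContDiffAt ℝ r f x
  contDiff_h : ∀ x ∈ X, ContDiffAt ℝ r h x
  f_zero : f 0 = 0
  h_zero : h 0 = 0
  /-- `∂f/∂x` is uniformly bounded above and below on `X`. -/
  jac_bounds : ∃ a b : ℝ, 0 < a ∧ 0 < b ∧ ∀ x ∈ X,
    ((jac f x)ᵀ * jac f x - a • (1 : Matrix (Fin N) (Fin N) ℝ)).PosSemidef ∧
    (b • (1 : Matrix (Fin N) (Fin N) ℝ) - (jac f x)ᵀ * jac f x).PosSemidef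
  /-- The observability rank condition. -/
  rank_condition : ∀ x ∈ X, (jac (obsMap f h) x).rank = N
  /-- Uniform bounds on the observability Gramian. -/
  obs_bounds : ∃ α β : ℝ, 0 < α ∧ 0 < β ∧ ∀ x ∈ X,
    ((jac (obsMap f h) x)ᵀ * jac (obsMap f h) x
      - α • (1 : Matrix (Fin N) (Fin N) ℝ)).PosDef ∧
    (β • (1 : Matrix (Fin N) (Fin N) ℝ)
      - (jac (obsMap f h) x)ᵀ * jac (obsMap f h) x).PosDef

/-- `ξ` is an i.i.d. sequence of `{0,1}`-valued random variables with `Prob(ξ_t = 1) = p`. -/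
structure IsErasureChannel {Ω : Type*} [MeasurableSpace Ω] (P : Measure Ω) (p : ℝ)
    (ξ : ℕ → Ω → ℝ) : Prop where
  measurable : ∀ t, Measurable (ξ t)
  values : ∀ t ω, ξ t ω = 0 ∨ ξ t ω = 1
  prob_one : ∀ t, P.real {ω | ξ t ω = 1} = p
  indep : iIndepFun ξ P

/-- One step of the observer: `f(z) + K(s h(x)) - K(s h(z))`, where `x` is the plant state, `z` the
observer state and `s` the channel state. -/
noncomputable def observerStep {N M : ℕ} (f : E N → E N) (h : E N → E M) (K : E M → E N)
    (s : ℝ) (x z : E N) : E N :=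
  f z + K (s • h x) - K (s • h z)

/-- The observer trajectory driven by the outputs of the plant started at `x₀`, for the channel
realization `s`, with initial observer state `z₀`. -/
noncomputable def observerState {N M : ℕ} (f : E N → E N) (h : E N → E M) (K : E M → E N)
    (s : ℕ → ℝ) (x₀ z₀ : E N) : ℕ → E N
  | 0 => z₀
  | t + 1 => observerStep f h K (s t) (f^[t] x₀) (observerState f h K s x₀ z₀ t)

/-- The observer error `e_t = x_t - x̂_t`. -/
noncomputable def observerError {N M : ℕ} (f : E N → E N) (h : E N → E M) (K : E M → E N)
    (s : ℕ → ℝ) (x₀ z₀ : E N) (t : ℕ) : E N :=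
  f^[t] x₀ - observerState f h K s x₀ z₀ t

/-- An admissible observer gain: `K` is `C^r` on the output space `Y`, `K(0) = 0`, and the observer
state stays in the state space `X`. -/
structure IsObserverGain {N M : ℕ} (r : WithTop ℕ∞) (X : Set (E N)) (Y : Set (E M))
    (f : E N → E N) (h : E N → E M) (K : E M → E N) : Prop where
  contDiff : ∀ y ∈ Y, ContDiffAt ℝ r K y
  zero : K 0 = 0
  step_mem : ∀ s : ℝ, (s = 0 ∨ s = 1) → ∀ x ∈ X, ∀ z ∈ X, observerStep f h K s x z ∈ X

/-- Mean-square exponential stability of the observer error dynamics. The integrand takes finitely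
many values, so it is always integrable. -/
def ErrorMSEStable {N M : ℕ} {Ω : Type*} [MeasurableSpace Ω] (P : Measure Ω) (ξ : ℕ → Ω → ℝ)
    (X : Set (E N)) (f : E N → E N) (h : E N → E M) (K : E M → E N) : Prop :=
  ∃ L β : ℝ, 0 < L ∧ 0 < β ∧ β < 1 ∧
    ∀ᵐ x₀ : E N, x₀ ∈ X → ∀ᵐ z₀ : E N, z₀ ∈ X → ∀ t : ℕ,
      ∫ ω, ‖observerError f h K (fun k => ξ k ω) x₀ z₀ (t + 1)‖ ^ 2 ∂P
        ≤ L * β ^ t * ‖x₀ - z₀‖ ^ 2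

/-- `Q` is uniformly bounded above and below (as symmetric matrices) on `X`. -/
def UniformlyBounded {N : ℕ} (X : Set (E N)) (Q : E N → Matrix (Fin N) (Fin N) ℝ) : Prop :=
  ∃ γ₁ γ₂ : ℝ, 0 < γ₁ ∧ 0 < γ₂ ∧ ∀ x ∈ X,
    (Q x - γ₁ • (1 : Matrix (Fin N) (Fin N) ℝ)).PosSemidef ∧
    (γ₂ • (1 : Matrix (Fin N) (Fin N) ℝ) - Q x).PosSemidef

/-- The state-parametrized Riccati equation on `X`, with `A = ∂f/∂x`, `C = ∂h/∂x`. -/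
def SolvesRiccati {N M : ℕ} (X : Set (E N)) (f : E N → E N) (h : E N → E M)
    (Q R : E N → Matrix (Fin N) (Fin N) ℝ) : Prop :=
  ∀ x ∈ X, Q (f x) =
    jac f x * Q x * (jac f x)ᵀ + R x
      - (jac f x * Q x * (jac h x)ᵀ)
        * (1 + jac h x * Q x * (jac h x)ᵀ)⁻¹
        * (jac h x * Q x * (jac f x)ᵀ)

end ErasureObserver

/-! Near `x̂ = x` the error evolves to first order by a random linear cocycle over `f`: its
generator at `x` is `A = ∂f/∂x` with probability `1 - p` and `D = A - (∂K/∂y) C` with probability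
`p`. Difference quotients carry the mean-square decay over to the second moments `E[Φ_tᵀ Φ_t]`, at
every state (`dotProduct_secondMoment_le`). Their sum `G` over `t` satisfies `I ≤ G ≤ γ I` and `G =
I + (1-p) Aᵀ G(f) A + p Dᵀ G(f) D` (`exists_lyapunov`).

Since `D = A` on `ker C`, there `Aᵀ G(f) A < G`; quantitatively, `Aᵀ G(f) A ≤ G + k Cᵀ C`
(`exists_le_add_mul_output`). For `Q = (G / k)⁻¹`, inverting this inequality says that `Q(f x)`
dominates the Riccati update without `R`, and `R` is the slack (`exists_riccati_of_lyapunov`).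

For the determinant, choose coordinates in which `Aᵀ G(f) A` is the identity. There `G` exceeds `1 -
p` everywhere and `1` on `ker C`, of codimension at most `M`. So at most `M` eigenvalues are `≤ 1`,
each above `1 - p`, and the product exceeds `(1-p)^M` (`pow_mul_det_lt_det`). -/

namespace ErasureObserver

/-! ### Determinant bounds, Schur complements and the information form -/

section MatrixFacts

lemma isHermitian_smul_one {ι : Type*} [DecidableEq ι] (c : ℝ) : (c • (1 : Matrix ι ι ℝ)).IsHermitian := by
  simp [IsHermitian]

lemma isHermitian_transpose_mul_mul {ι κ : Type*} [Fintype κ] {S : Matrix κ κ ℝ} (hS : S.IsHermitian) (U : Matrix κ ι ℝ) :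
    (Uᵀ * S * U).IsHermitian := by
  simpa using isHermitian_conjTranspose_mul_mul U hS

lemma posDef_of_posSemidef_sub_smul_one {ι : Type*} [DecidableEq ι] {S : Matrix ι ι ℝ} {c : ℝ} (hc : 0 < c)
    (h : (S - c • (1 : Matrix ι ι ℝ)).PosSemidef) : S.PosDef := by
  simpa using PosDef.posSemidef_add h (PosDef.one.smul hc)

variable {ι κ : Type*} [Fintype ι] [Fintype κ]

lemma posSemidef_sub_iff {S T : Matrix ι ι ℝ} (hS : S.IsHermitian) (hT : T.IsHermitian) :
    (T - S).PosSemidef ↔ ∀ v : ι → ℝ, v ⬝ᵥ S *ᵥ v ≤ v ⬝ᵥ T *ᵥ v := by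
  rw [posSemidef_iff_dotProduct_mulVec]
  simp only [star_trivial, sub_mulVec, dotProduct_sub, sub_nonneg, hT.sub hS, true_and]

lemma dotProduct_mulVec_transpose_mul_mul (S : Matrix κ κ ℝ) (U : Matrix κ ι ℝ) (v : ι → ℝ) :
    v ⬝ᵥ (Uᵀ * S * U) *ᵥ v = (U *ᵥ v) ⬝ᵥ S *ᵥ (U *ᵥ v) := by
  rw [← mulVec_mulVec, ← mulVec_mulVec, dotProduct_mulVec, vecMul_transpose]

lemma dotProduct_mulVec_transpose_mul (U : Matrix κ ι ℝ) (v : ι → ℝ) :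
    v ⬝ᵥ (Uᵀ * U) *ᵥ v = (U *ᵥ v) ⬝ᵥ (U *ᵥ v) := by
  rw [← mulVec_mulVec, dotProduct_mulVec, vecMul_transpose]

lemma dotProduct_smul_one_mulVec [DecidableEq ι] (c : ℝ) (v : ι → ℝ) :
    v ⬝ᵥ (c • (1 : Matrix ι ι ℝ)) *ᵥ v = c * (v ⬝ᵥ v) := by
  simp [smul_mulVec]

/-- A symmetric form that exceeds `q` times the Euclidean one, and exceeds the Euclidean one on the
kernel of a matrix with `M` rows, has determinant larger than `q ^ M`. -/
lemma pow_lt_det [DecidableEq ι] [Nonempty ι] {M : ℕ} {G : Matrix ι ι ℝ} (hG : G.IsHermitian)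
    (V : Matrix (Fin M) ι ℝ) {q : ℝ} (hq0 : 0 < q) (hq1 : q < 1)
    (h1 : ∀ v ≠ 0, q * (v ⬝ᵥ v) < v ⬝ᵥ G *ᵥ v)
    (h2 : ∀ v ≠ 0, V *ᵥ v = 0 → v ⬝ᵥ v < v ⬝ᵥ G *ᵥ v) : q ^ M < G.det := by
  set e := hG.eigenvectorBasis
  set lam := hG.eigenvalues
  have hinner : ∀ u w : EuclideanSpace ℝ ι, inner ℝ u w = u.ofLp ⬝ᵥ w.ofLp := fun u w => by
    rw [EuclideanSpace.inner_eq_star_dotProduct, star_trivial, dotProduct_comm]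
  have hone : ∀ i, (e i).ofLp ⬝ᵥ (e i).ofLp = 1 := fun i => by
    rw [← hinner, real_inner_self_eq_norm_sq, e.orthonormal.1 i, one_pow]
  have hne : ∀ i, (e i).ofLp ≠ 0 := fun i h0 => by simpa [h0] using hone i
  have hGe : ∀ i, G *ᵥ (e i).ofLp = lam i • (e i).ofLp := hG.mulVec_eigenvectorBasis
  have hlam : ∀ i, q < lam i := fun i => by
    have := h1 _ (hne i)
    rw [hGe, dotProduct_smul, hone] at this
    simpa using this
  set s : Finset ι := Finset.univ.filter fun i => lam i ≤ 1
  -- A relation among the `V eᵢ`, `i ∈ s`, gives `w ∈ ker V` in the span of eigenvectors with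
  -- eigenvalue at most `1`; then `w ⬝ᵥ G w ≤ w ⬝ᵥ w`, which `h2` allows only for `w = 0`. Hence `s`
  -- has at most `M` elements.
  have hli : LinearIndepOn ℝ (fun i => V *ᵥ (e i).ofLp) (s : Set ι) := by
    rw [linearIndepOn_finset_iff]
    intro c hc
    set w : EuclideanSpace ℝ ι := ∑ i ∈ s, c i • e i with hw
    set w' : EuclideanSpace ℝ ι := ∑ i ∈ s, (c i * lam i) • e i with hw'
    have hVw : V *ᵥ w.ofLp = 0 := by
      rw [← hc, hw, WithLp.ofLp_sum, mulVec_sum]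
      simp [mulVec_smul]
    have hGw : G *ᵥ w.ofLp = w'.ofLp := by
      rw [hw, hw', WithLp.ofLp_sum, WithLp.ofLp_sum, mulVec_sum]
      refine Finset.sum_congr rfl fun i _ => ?_
      simp [mulVec_smul, hGe, smul_smul]
    have hle : w.ofLp ⬝ᵥ G *ᵥ w.ofLp ≤ w.ofLp ⬝ᵥ w.ofLp := by
      rw [hGw, ← hinner, ← hinner, hw, hw', e.orthonormal.inner_sum, e.orthonormal.inner_sum]
      refine Finset.sum_le_sum fun i hi => ?_
      have : lam i ≤ 1 := (Finset.mem_filter.1 hi).2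
      simp only [conj_trivial]
      nlinarith [mul_self_nonneg (c i)]
    have hw0 : w = 0 := by
      by_contra hne0
      exact absurd (h2 w.ofLp (by simpa using hne0) hVw) (not_lt.2 hle)
    exact linearIndepOn_finset_iff.1 (e.orthonormal.linearIndependent.linearIndepOn (s : Set ι))
      c hw0
  have hcard : s.card ≤ M := by
    simpa using LinearIndependent.fintype_card_le_finrank hli
  have hdet : G.det = ∏ i, lam i := by simpa using hG.det_eq_prod_eigenvalues
  calc q ^ M ≤ q ^ s.card := pow_le_pow_of_le_one hq0.le hq1.le hcard
    _ = ∏ i, if lam i ≤ 1 then q else 1 := by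
        rw [Finset.prod_ite, Finset.prod_const, Finset.prod_const_one, mul_one]
    _ < ∏ i, lam i := by
        refine Finset.prod_lt_prod_of_nonempty (fun i _ => ?_) (fun i _ => ?_)
          Finset.univ_nonempty
        · split_ifs <;> positivity
        · split_ifs with hi
          · exact hlam i
          · exact not_le.1 hi
    _ = G.det := hdet.symm

/-- The Jacobian-weighted determinant inequality for one step of an erasure Lyapunov inequality. -/
lemma pow_mul_det_lt_det [DecidableEq ι] [Nonempty ι] {M : ℕ} {P₀ P₁ A D : Matrix ι ι ℝ}
    {C : Matrix (Fin M) ι ℝ} {p : ℝ} (hp0 : 0 < p) (hp1 : p < 1)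
    (hP₀ : P₀.IsHermitian) (hP₁ : P₁.PosDef) (hA : A.det ≠ 0)
    (hD : ∀ v, C *ᵥ v = 0 → D *ᵥ v = A *ᵥ v)
    (hlt : ∀ v ≠ 0, (1 - p) * ((A *ᵥ v) ⬝ᵥ P₁ *ᵥ (A *ᵥ v)) + p * ((D *ᵥ v) ⬝ᵥ P₁ *ᵥ (D *ᵥ v))
      < v ⬝ᵥ P₀ *ᵥ v) :
    (1 - p) ^ M * A.det ^ 2 * P₁.det < P₀.det := by
  obtain ⟨B, hB⟩ : ∃ B : Matrix ι ι ℝ, P₁ = Bᵀ * B := by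
    open scoped MatrixOrder in
    obtain ⟨B, hB⟩ := CStarAlgebra.nonneg_iff_eq_star_mul_self.mp hP₁.posSemidef.nonneg
    exact ⟨B, by simpa [star_eq_conjTranspose] using hB⟩
  have hBdet : B.det ≠ 0 := by
    intro h0
    have := hP₁.det_pos
    simp [hB, h0] at this
  -- `Aᵀ P₁ A = Wᵀ W`, so the substitution `v = W⁻¹ u` turns this form into the Euclidean one. On
  -- `ker C` the weights `1 - p` and `p` fall on the same vector and add up to `1`.
  set W := B * A with hW
  have hWu : IsUnit W.det := by simp [hW, hBdet, hA]
  have hAW : ∀ u, (A *ᵥ (W⁻¹ *ᵥ u)) ⬝ᵥ P₁ *ᵥ (A *ᵥ (W⁻¹ *ᵥ u)) = u ⬝ᵥ u := by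
    intro u
    rw [hB, dotProduct_mulVec_transpose_mul, mulVec_mulVec, ← hW, mulVec_mulVec,
      mul_nonsing_inv _ hWu, one_mulVec]
  have hP₁nn : ∀ u, 0 ≤ u ⬝ᵥ P₁ *ᵥ u := fun u => by
    simpa using hP₁.posSemidef.dotProduct_mulVec_nonneg u
  have hne : ∀ u ≠ 0, W⁻¹ *ᵥ u ≠ 0 := fun u hu h0 => hu <| by
    rw [← one_mulVec u, ← mul_nonsing_inv _ hWu, ← mulVec_mulVec, h0, mulVec_zero]
  have key := pow_lt_det (G := (W⁻¹)ᵀ * P₀ * W⁻¹) (isHermitian_transpose_mul_mul hP₀ _)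
    (C * W⁻¹) (q := 1 - p) (by linarith) (by linarith)
    (fun v hv => by
      have := hlt _ (hne v hv)
      rw [hAW] at this
      rw [dotProduct_mulVec_transpose_mul_mul]
      nlinarith [hP₁nn (D *ᵥ (W⁻¹ *ᵥ v))])
    (fun v hv hCv => by
      have := hlt _ (hne v hv)
      rw [hD _ (by rwa [mulVec_mulVec]), hAW] at this
      rw [dotProduct_mulVec_transpose_mul_mul]
      linarith)
  have hWd : W.det ^ 2 = A.det ^ 2 * P₁.det := by
    rw [hW, hB, det_mul, det_mul, det_transpose]; ring
  have hpos : 0 < W.det ^ 2 := by have := hWu.ne_zero; positivity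
  rw [det_mul, det_mul, det_transpose, det_nonsing_inv, Ring.inverse_eq_inv'] at key
  calc (1 - p) ^ M * A.det ^ 2 * P₁.det = (1 - p) ^ M * W.det ^ 2 := by rw [hWd]; ring
    _ < W.det⁻¹ * P₀.det * W.det⁻¹ * W.det ^ 2 := by gcongr
    _ = P₀.det := by field_simp [hWu.ne_zero]

/-- Order reversal of inversion, with a congruence, through the two Schur complements of a block
matrix. -/
lemma posSemidef_inv_sub [DecidableEq ι] [DecidableEq κ] {S : Matrix ι ι ℝ} {W : Matrix κ κ ℝ}
    (hS : S.PosDef) (hW : W.PosDef) (A : Matrix ι κ ℝ) (h : (W - Aᵀ * S * A).PosSemidef) :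
    (S⁻¹ - A * W⁻¹ * Aᵀ).PosSemidef := by
  have := hS.isUnit.invertible
  have := hW.isUnit.invertible
  have := hS.inv.isUnit.invertible
  have hSS : S⁻¹⁻¹ = S := nonsing_inv_nonsing_inv _ ((isUnit_iff_isUnit_det _).1 hS.isUnit)
  have h1 := (hS.inv.fromBlocks₁₁ A W).2 (by simpa [hSS] using h)
  simpa using (PosDef.fromBlocks₂₂ S⁻¹ A hW).1 h1

/-- The Riccati update in information form. -/
lemma riccati_eq_information [DecidableEq ι] [DecidableEq κ] {S : Matrix ι ι ℝ} (hS : S.PosDef)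
    (A : Matrix ι ι ℝ) (C : Matrix κ ι ℝ) :
    A * S⁻¹ * Aᵀ - (A * S⁻¹ * Cᵀ) * (1 + C * S⁻¹ * Cᵀ)⁻¹ * (C * S⁻¹ * Aᵀ)
      = A * (S + Cᵀ * C)⁻¹ * Aᵀ := by
  have hpd : (1 + C * S⁻¹ * Cᵀ).PosDef :=
    PosDef.one.add_posSemidef (by simpa using hS.inv.posSemidef.mul_mul_conjTranspose_same C)
  -- The Woodbury identity for `(S + Cᵀ C)⁻¹`.
  have h := add_mul_mul_inv_eq_sub S Cᵀ 1 C hS.isUnit isUnit_one (by simpa using hpd.isUnit)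
  rw [Matrix.mul_one, inv_one] at h
  rw [h]
  simp only [Matrix.mul_sub, Matrix.sub_mul, Matrix.mul_assoc]

/-- A matrix `C` with `C Cᵀ ≥ δ` has a right inverse of norm at most `1 / √δ`. -/
lemma exists_mulVec_eq_of_row_rank [DecidableEq κ] {C : Matrix κ ι ℝ} {δ : ℝ} (hδ : 0 < δ)
    (h : (C * Cᵀ - δ • (1 : Matrix κ κ ℝ)).PosSemidef) (u : κ → ℝ) :
    ∃ y : ι → ℝ, C *ᵥ y = u ∧ δ * (y ⬝ᵥ y) ≤ u ⬝ᵥ u := by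
  have hpd := posDef_of_posSemidef_sub_smul_one hδ h
  have hu := (isUnit_iff_isUnit_det _).1 hpd.isUnit
  -- `Cᵀ w` is the least-norm preimage of `u`, of squared norm `w ⬝ᵥ u`. The bound combines `δ |w|²
  -- ≤ w ⬝ᵥ u` with `|u - δ w|² ≥ 0`.
  set w := (C * Cᵀ)⁻¹ *ᵥ u
  have hw : (C * Cᵀ) *ᵥ w = u := by simp [w, mulVec_mulVec, mul_nonsing_inv _ hu]
  have hyy : (Cᵀ *ᵥ w) ⬝ᵥ (Cᵀ *ᵥ w) = w ⬝ᵥ u := by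
    rw [← dotProduct_mulVec_transpose_mul, transpose_transpose, hw]
  refine ⟨Cᵀ *ᵥ w, by rw [mulVec_mulVec, hw], ?_⟩
  have h1 := (posSemidef_sub_iff (isHermitian_smul_one δ) hpd.isHermitian).1 h w
  rw [dotProduct_smul_one_mulVec, hw] at h1
  have h2 : 0 ≤ (u - δ • w) ⬝ᵥ (u - δ • w) := by
    simpa using dotProduct_star_self_nonneg (u - δ • w)
  simp only [sub_dotProduct, dotProduct_sub, smul_dotProduct, dotProduct_smul, smul_eq_mul,
    dotProduct_comm u w] at h2
  rw [hyy]
  nlinarith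

end MatrixFacts

/-! ### Second moments of the linear cocycle and the Lyapunov equation -/

section SecondMoments

lemma hasSum_dotProduct {ι : Type*} [Fintype ι] {T : ℕ → Matrix ι ι ℝ} (hT : Summable T) (v : ι → ℝ) :
    HasSum (fun t => v ⬝ᵥ T t *ᵥ v) (v ⬝ᵥ (∑' t, T t) *ᵥ v) := by
  let φ : Matrix ι ι ℝ →+ ℝ :=
    { toFun := fun S => v ⬝ᵥ S *ᵥ v
      map_zero' := by simp
      map_add' := fun S S' => by rw [add_mulVec, dotProduct_add] }
  exact hT.hasSum.map φ (show Continuous fun S : Matrix ι ι ℝ => v ⬝ᵥ S *ᵥ v by fun_prop)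

variable {α ι : Type*} [Fintype ι] [DecidableEq ι]

/-- The second moments `E[Φ_tᵀ Φ_t]` of the linear cocycle over `f` whose generator at `x` is
`D x` with probability `p` and `A x` with probability `1 - p`. -/
noncomputable def secondMoment (p : ℝ) (f : α → α) (A D : α → Matrix ι ι ℝ) :
    ℕ → α → Matrix ι ι ℝ
  | 0, _ => 1
  | t + 1, x => (1 - p) • ((A x)ᵀ * secondMoment p f A D t (f x) * A x)
      + p • ((D x)ᵀ * secondMoment p f A D t (f x) * D x)

lemma dotProduct_secondMoment_succ (p : ℝ) (f : α → α) (A D : α → Matrix ι ι ℝ) (t : ℕ) (x : α)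
    (v : ι → ℝ) :
    v ⬝ᵥ secondMoment p f A D (t + 1) x *ᵥ v
      = (1 - p) * ((A x *ᵥ v) ⬝ᵥ secondMoment p f A D t (f x) *ᵥ (A x *ᵥ v))
        + p * ((D x *ᵥ v) ⬝ᵥ secondMoment p f A D t (f x) *ᵥ (D x *ᵥ v)) := by
  rw [secondMoment, add_mulVec, smul_mulVec, smul_mulVec, dotProduct_add, dotProduct_smul,
    dotProduct_smul, dotProduct_mulVec_transpose_mul_mul, dotProduct_mulVec_transpose_mul_mul,
    smul_eq_mul, smul_eq_mul]

lemma posSemidef_secondMoment {p : ℝ} (hp0 : 0 ≤ p) (hp1 : p ≤ 1) (f : α → α)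
    (A D : α → Matrix ι ι ℝ) (t : ℕ) (x : α) : (secondMoment p f A D t x).PosSemidef := by
  induction t generalizing x with
  | zero => exact PosSemidef.one
  | succ t ih =>
    have h1 := (ih (f x)).conjTranspose_mul_mul_same (A x)
    have h2 := (ih (f x)).conjTranspose_mul_mul_same (D x)
    rw [conjTranspose_eq_transpose_of_trivial] at h1 h2
    exact (h1.smul (sub_nonneg.2 hp1)).add (h2.smul hp0)

lemma apply_eq_polarization {T : Matrix ι ι ℝ} (hT : T.IsHermitian) (i j : ι) :
    T i j = ((Pi.single i 1 + Pi.single j 1) ⬝ᵥ T *ᵥ (Pi.single i 1 + Pi.single j 1)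
      - Pi.single i 1 ⬝ᵥ T *ᵥ Pi.single i 1 - Pi.single j 1 ⬝ᵥ T *ᵥ Pi.single j 1) / 2 := by
  have : T j i = T i j := by simpa using hT.apply i j
  simp only [mulVec_add, dotProduct_add, add_dotProduct, mulVec_single_one, single_one_dotProduct,
    col_apply, this]
  ring

/-- By polarization each entry is a combination of three values of the quadratic form, so bounds on
forms suffice for convergence of the matrix series. -/
lemma summable_of_summable_dotProduct {T : ℕ → Matrix ι ι ℝ} (hT : ∀ t, (T t).IsHermitian)
    (h : ∀ v : ι → ℝ, Summable fun t => v ⬝ᵥ T t *ᵥ v) : Summable T := by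
  refine Pi.summable.2 fun i => Pi.summable.2 fun j => ?_
  simp_rw [fun t => apply_eq_polarization (hT t) i j]
  exact (((h _).sub (h _)).sub (h _)).div_const 2

/-- Exponential decay of the second moments yields a bounded solution of the stochastic Lyapunov
equation. -/
lemma exists_lyapunov {p L β : ℝ} (hp0 : 0 ≤ p) (hp1 : p ≤ 1) (hL : 0 < L) (hβ0 : 0 < β)
    (hβ1 : β < 1) {X : Set α} {f : α → α} (hf : Set.MapsTo f X X) {A D : α → Matrix ι ι ℝ}
    (hdecay : ∀ x ∈ X, ∀ t v,
      v ⬝ᵥ secondMoment p f A D (t + 1) x *ᵥ v ≤ L * β ^ t * (v ⬝ᵥ v)) :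
    ∃ P : α → Matrix ι ι ℝ, ∃ γ : ℝ, 0 < γ ∧ ∀ x ∈ X, (P x).IsHermitian ∧
      (∀ v, v ⬝ᵥ v ≤ v ⬝ᵥ P x *ᵥ v) ∧ (∀ v, v ⬝ᵥ P x *ᵥ v ≤ γ * (v ⬝ᵥ v)) ∧
      ∀ v, v ⬝ᵥ P x *ᵥ v = v ⬝ᵥ v + ((1 - p) * ((A x *ᵥ v) ⬝ᵥ P (f x) *ᵥ (A x *ᵥ v))
        + p * ((D x *ᵥ v) ⬝ᵥ P (f x) *ᵥ (D x *ᵥ v))) := by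
  set T := secondMoment p f A D with hT
  have hpsd := posSemidef_secondMoment hp0 hp1 f A D
  have hnn : ∀ t x v, 0 ≤ v ⬝ᵥ T t x *ᵥ v := fun t x v => by
    simpa using (hpsd t x).dotProduct_mulVec_nonneg v
  have hgeom : ∀ v : ι → ℝ, HasSum (fun t => L * β ^ t * (v ⬝ᵥ v)) (L * (1 - β)⁻¹ * (v ⬝ᵥ v)) :=
    fun v => ((hasSum_geometric_of_lt_one hβ0.le hβ1).mul_left L).mul_right _
  have hsum : ∀ x ∈ X, Summable fun t => T t x := fun x hx =>
    summable_of_summable_dotProduct (fun t => (hpsd t x).isHermitian) fun v =>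
      (summable_nat_add_iff 1).1 <|
        Summable.of_nonneg_of_le (fun t => hnn _ x v) (fun t => hdecay x hx t v) (hgeom v).summable
  have hP : ∀ x ∈ X, ∀ v, HasSum (fun t => v ⬝ᵥ T t x *ᵥ v) (v ⬝ᵥ (∑' t, T t x) *ᵥ v) :=
    fun x hx v => hasSum_dotProduct (hsum x hx) v
  have hzero : ∀ x v, v ⬝ᵥ T 0 x *ᵥ v = v ⬝ᵥ v := fun x v => by simp [hT, secondMoment]
  -- The decay estimate starts at index `1`. The split-off term `v ⬝ᵥ v` supplies the lower bound on
  -- the sum and the `1` in `γ = 1 + L / (1 - β)`.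
  have hshift : ∀ x ∈ X, ∀ v, HasSum (fun t => v ⬝ᵥ T (t + 1) x *ᵥ v)
      (v ⬝ᵥ (∑' t, T t x) *ᵥ v - v ⬝ᵥ v) := fun x hx v => by
    have := (hasSum_nat_add_iff' 1).2 (hP x hx v)
    simpa only [Finset.sum_range_one, hzero] using this
  refine ⟨fun x => ∑' t, T t x, 1 + L * (1 - β)⁻¹, ?_, fun x hx => ⟨?_, fun v => ?_, fun v => ?_,
    fun v => ?_⟩⟩
  · have : 0 < 1 - β := sub_pos.2 hβ1
    positivity
  · rw [IsHermitian, conjTranspose_tsum]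
    exact tsum_congr fun t => (hpsd t x).isHermitian
  · have := (hshift x hx v).nonneg fun t => hnn _ x v
    linarith
  · have := hasSum_le (fun t => hdecay x hx t v) (hshift x hx v) (hgeom v)
    linarith
  · have h1 := ((hP (f x) (hf hx) (A x *ᵥ v)).mul_left (1 - p)).add
      ((hP (f x) (hf hx) (D x *ᵥ v)).mul_left p)
    have h2 := hshift x hx v
    simp_rw [hT, dotProduct_secondMoment_succ] at h2
    have := h2.unique h1
    linarith

end SecondMoments

/-! ### Domination up to output injection -/

/-- The open-loop congruence of a Lyapunov solution is dominated up to an output injection term. -/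
lemma exists_le_add_mul_output {ι κ : Type*} [Fintype ι] [Fintype κ] [DecidableEq κ] {p L b δ γ : ℝ}
    (hp0 : 0 < p) (hL : 0 < L) (hb : 0 < b) (hδ : 0 < δ) (hγ : 0 < γ) :
    ∃ k : ℝ, 0 < k ∧ ∀ (P₀ P₁ A D : Matrix ι ι ℝ) (C : Matrix κ ι ℝ),
      P₁.IsHermitian → (∀ v, 0 ≤ v ⬝ᵥ P₁ *ᵥ v) → (∀ v, v ⬝ᵥ P₁ *ᵥ v ≤ γ * (v ⬝ᵥ v)) →
      (∀ v, (A *ᵥ v) ⬝ᵥ (A *ᵥ v) ≤ b * (v ⬝ᵥ v)) →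
      (∀ v, p * ((D *ᵥ v) ⬝ᵥ (D *ᵥ v)) ≤ L * (v ⬝ᵥ v)) →
      (∀ v, C *ᵥ v = 0 → D *ᵥ v = A *ᵥ v) →
      (C * Cᵀ - δ • (1 : Matrix κ κ ℝ)).PosSemidef →
      (∀ v, v ⬝ᵥ v + ((1 - p) * ((A *ᵥ v) ⬝ᵥ P₁ *ᵥ (A *ᵥ v))
        + p * ((D *ᵥ v) ⬝ᵥ P₁ *ᵥ (D *ᵥ v))) ≤ v ⬝ᵥ P₀ *ᵥ v) →
      ∀ v, (A *ᵥ v) ⬝ᵥ P₁ *ᵥ (A *ᵥ v) ≤ v ⬝ᵥ P₀ *ᵥ v + k * ((C *ᵥ v) ⬝ᵥ (C *ᵥ v)) := by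
  -- Write `A v = u + w` with `u = D v`. Young's inequality with weight `(γ L)⁻¹` makes the `u` part
  -- of the cross term at most `v ⬝ᵥ v`, which the Lyapunov inequality has to spare. What remains is
  -- `p (1 + γ L)` times the form at `w`, bounded through `γ` and `hwle`.
  refine ⟨p * (1 + γ * L) * γ * (2 * (b + L / p) / δ), by positivity, ?_⟩
  intro P₀ P₁ A D C hP₁ hnn hγ' hA hD hDA hC hP v
  have hself : ∀ u : ι → ℝ, 0 ≤ u ⬝ᵥ u := fun u => by simpa using dotProduct_star_self_nonneg u
  obtain ⟨y, hy, hyle⟩ := exists_mulVec_eq_of_row_rank hδ hC (C *ᵥ v)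
  set u := D *ᵥ v with hu
  set w := A *ᵥ v - D *ᵥ v with hw
  -- `A - D` vanishes on `ker C`, so `v` may be replaced by the preimage `y` of `C v`, whose size is
  -- controlled by `C v`.
  have hwy : w = A *ᵥ y - D *ᵥ y := by
    have := hDA (v - y) (by rw [mulVec_sub, hy, sub_self])
    rw [mulVec_sub, mulVec_sub] at this
    rw [hw, sub_eq_sub_iff_sub_eq_sub, this.symm]
  have hAy := hA y
  have hDy : (D *ᵥ y) ⬝ᵥ (D *ᵥ y) ≤ L / p * (y ⬝ᵥ y) := by
    rw [div_mul_eq_mul_div, le_div_iff₀ hp0, mul_comm]; exact hD y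
  have hwle : w ⬝ᵥ w ≤ 2 * (b + L / p) / δ * ((C *ᵥ v) ⬝ᵥ (C *ᵥ v)) := by
    have h1 : w ⬝ᵥ w ≤ 2 * (b + L / p) * (y ⬝ᵥ y) := by
      have := hself (A *ᵥ y + D *ᵥ y)
      rw [hwy]
      simp only [add_dotProduct, dotProduct_add, sub_dotProduct, dotProduct_sub] at this ⊢
      linarith
    have h2 : y ⬝ᵥ y ≤ (C *ᵥ v) ⬝ᵥ (C *ᵥ v) / δ := by rwa [le_div_iff₀ hδ, mul_comm]
    calc w ⬝ᵥ w ≤ 2 * (b + L / p) * ((C *ᵥ v) ⬝ᵥ (C *ᵥ v) / δ) :=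
          h1.trans (mul_le_mul_of_nonneg_left h2 (by positivity))
      _ = _ := by ring
  have hAv : A *ᵥ v = u + w := by rw [hu, hw]; abel
  have hsymm : w ⬝ᵥ P₁ *ᵥ u = u ⬝ᵥ P₁ *ᵥ w := by
    rw [dotProduct_mulVec, ← mulVec_transpose, dotProduct_comm]
    simpa using congrArg (fun S => u ⬝ᵥ S *ᵥ w) hP₁
  have hcross : 2 * (u ⬝ᵥ P₁ *ᵥ w)
      ≤ (γ * L)⁻¹ * (u ⬝ᵥ P₁ *ᵥ u) + γ * L * (w ⬝ᵥ P₁ *ᵥ w) := by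
    have h0 := hnn ((γ * L)⁻¹ • u - w)
    simp only [mulVec_sub, mulVec_smul, sub_dotProduct, dotProduct_sub, smul_dotProduct,
      dotProduct_smul, smul_eq_mul, hsymm] at h0
    have h1 := mul_nonneg (show 0 ≤ γ * L by positivity) h0
    have h2 : γ * L * (γ * L)⁻¹ = 1 := mul_inv_cancel₀ (by positivity)
    linear_combination h1 + ((γ * L)⁻¹ * (u ⬝ᵥ P₁ *ᵥ u) - 2 * (u ⬝ᵥ P₁ *ᵥ w)) * h2
  have hsmall : p * ((γ * L)⁻¹ * (u ⬝ᵥ P₁ *ᵥ u)) ≤ v ⬝ᵥ v := by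
    calc p * ((γ * L)⁻¹ * (u ⬝ᵥ P₁ *ᵥ u)) ≤ p * ((γ * L)⁻¹ * (γ * (u ⬝ᵥ u))) := by
          gcongr; exact hγ' u
      _ = L⁻¹ * (p * (u ⬝ᵥ u)) := by field_simp
      _ ≤ L⁻¹ * (L * (v ⬝ᵥ v)) := mul_le_mul_of_nonneg_left (hD v) (by positivity)
      _ = v ⬝ᵥ v := by field_simp
  have hbig : p * (1 + γ * L) * (w ⬝ᵥ P₁ *ᵥ w)
      ≤ p * (1 + γ * L) * γ * (2 * (b + L / p) / δ) * ((C *ᵥ v) ⬝ᵥ (C *ᵥ v)) := by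
    calc p * (1 + γ * L) * (w ⬝ᵥ P₁ *ᵥ w)
        ≤ p * (1 + γ * L) * (γ * (2 * (b + L / p) / δ * ((C *ᵥ v) ⬝ᵥ (C *ᵥ v)))) :=
          mul_le_mul_of_nonneg_left ((hγ' w).trans (mul_le_mul_of_nonneg_left hwle hγ.le))
            (by positivity)
      _ = _ := by ring
  have hexp : (A *ᵥ v) ⬝ᵥ P₁ *ᵥ (A *ᵥ v)
      = u ⬝ᵥ P₁ *ᵥ u + 2 * (u ⬝ᵥ P₁ *ᵥ w) + w ⬝ᵥ P₁ *ᵥ w := by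
    rw [hAv]
    simp only [mulVec_add, add_dotProduct, dotProduct_add, hsymm]
    ring
  have hpc := mul_le_mul_of_nonneg_left hcross hp0.le
  have := hP v
  nlinarith

/-! ### Expectation over the channel as a recursion -/

section Channel

variable {N M : ℕ}

/-- The mean-square observer error after `t` steps, computed by conditioning on the first channel
state. -/
noncomputable def meanSqError (p : ℝ) (f : E N → E N) (h : E N → E M) (K : E M → E N) :
    ℕ → E N → E N → ℝ
  | 0, x, z => ‖x - z‖ ^ 2
  | t + 1, x, z => (1 - p) * meanSqError p f h K t (f x) (observerStep f h K 0 x z)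
      + p * meanSqError p f h K t (f x) (observerStep f h K 1 x z)

/-- The definition peels off the last step; conditioning on the first channel state requires peeling
off the first. -/
lemma observerState_succ' (f : E N → E N) (h : E N → E M) (K : E M → E N) (s : ℕ → ℝ)
    (x z : E N) (t : ℕ) :
    observerState f h K s x z (t + 1)
      = observerState f h K (fun j => s (j + 1)) (f x) (observerStep f h K (s 0) x z) t := by
  induction t with
  | zero => rfl
  | succ t ih => rw [observerState, ih, observerState, ← Function.iterate_succ_apply]

lemma observerError_succ' (f : E N → E N) (h : E N → E M) (K : E M → E N) (s : ℕ → ℝ)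
    (x z : E N) (t : ℕ) :
    observerError f h K s x z (t + 1)
      = observerError f h K (fun j => s (j + 1)) (f x) (observerStep f h K (s 0) x z) t := by
  rw [observerError, observerState_succ', observerError, Function.iterate_succ_apply]

lemma observerState_congr (f : E N → E N) (h : E N → E M) (K : E M → E N) {s s' : ℕ → ℝ}
    (x z : E N) {t : ℕ} (hs : ∀ j < t, s j = s' j) :
    observerState f h K s x z t = observerState f h K s' x z t := by
  induction t with
  | zero => rfl
  | succ t ih =>
    rw [observerState, observerState, ih fun j hj => hs j (hj.trans t.lt_succ_self),
      hs t t.lt_succ_self]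

variable {Ω : Type*} [MeasurableSpace Ω] {P : Measure Ω} {p : ℝ} {ξ : ℕ → Ω → ℝ}

/-- A function of finitely many later channel states is independent of the present one. -/
lemma IsErasureChannel.integral_mul_eq [IsProbabilityMeasure P] (hξ : IsErasureChannel P p ξ)
    (k t : ℕ) (F : (ℕ → ℝ) → ℝ) (hF : ∀ s s' : ℕ → ℝ, (∀ j < t, s j = s' j) → F s = F s') :
    Integrable (fun ω => F fun j => ξ (k + 1 + j) ω) P ∧
    ∫ ω, ξ k ω * F (fun j => ξ (k + 1 + j) ω) ∂P = p * ∫ ω, F (fun j => ξ (k + 1 + j) ω) ∂P := by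
  classical
  -- Coding channel states in `Bool` leaves finitely many histories, so `F`, not assumed measurable,
  -- becomes measurable and bounded along the channel.
  let c : ℝ → Bool := fun r => decide (r = 1)
  have hc : Measurable c := measurable_to_bool (by
    have : c ⁻¹' {true} = {1} := by ext; simp [c]
    rw [this]; exact measurableSet_singleton 1)
  let toReal : Bool → ℝ := fun b => if b then 1 else 0
  have hcξ : ∀ j ω, toReal (c (ξ j ω)) = ξ j ω := fun j ω => by
    rcases hξ.values j ω with h0 | h0 <;> simp [c, toReal, h0]
  have hmeas : ∀ j, Measurable fun ω => c (ξ j ω) := fun j => hc.comp (hξ.measurable j)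
  have hind : iIndepFun (fun j ω => c (ξ j ω)) P := hξ.indep.comp (fun _ => c) fun _ => hc
  set S : Finset ℕ := {k}
  set T : Finset ℕ := Finset.Ioc k (k + t) with hT
  have hdisj : Disjoint S T := by simp [S, T]
  have hpair := hind.indepFun_finset S T hdisj hmeas
  let φ : (S → Bool) → ℝ := fun b => toReal (b ⟨k, by simp [S]⟩)
  -- The default `0` outside `T` is harmless: `F` depends only on indices `j < t`, and `T` is the
  -- times `k + 1, …, k + t`.
  let ψ : (T → Bool) → ℝ := fun b =>
    F fun j => if hj : k + 1 + j ∈ T then toReal (b ⟨k + 1 + j, hj⟩) else 0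
  have hψξ : ∀ ω, ψ (fun i : T => c (ξ i ω)) = F fun j => ξ (k + 1 + j) ω := fun ω => by
    refine hF _ _ fun j hj => ?_
    have hm : k + 1 + j ∈ T := by simp only [hT, Finset.mem_Ioc]; omega
    simp [hm, hcξ]
  have hφξ : ∀ ω, φ (fun i : S => c (ξ i ω)) = ξ k ω := fun ω => hcξ k ω
  have hφm : Measurable φ := measurable_of_finite φ
  have hψm : Measurable ψ := measurable_of_finite ψ
  have htm : Measurable fun ω => fun i : T => c (ξ i ω) :=
    measurable_pi_lambda _ fun i => hmeas i
  have hFm : Measurable fun ω => F fun j => ξ (k + 1 + j) ω := by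
    simp_rw [← hψξ]; exact hψm.comp htm
  have hFint : Integrable (fun ω => F fun j => ξ (k + 1 + j) ω) P := by
    obtain ⟨B, hB⟩ := (Set.finite_range fun b => ‖ψ b‖).bddAbove
    refine Integrable.of_bound hFm.aestronglyMeasurable B (Filter.Eventually.of_forall fun ω => ?_)
    rw [← hψξ]
    exact hB ⟨fun i : T => c (ξ i ω), rfl⟩
  refine ⟨hFint, ?_⟩
  have hprod := (hpair.comp hφm hψm).integral_mul_eq_mul_integral
    (hφm.comp (measurable_pi_lambda _ fun i => hmeas i)).aestronglyMeasurable
    (hψm.comp htm).aestronglyMeasurable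
  have hξint : ∫ ω, ξ k ω ∂P = p := by
    have h1 : ∀ ω, ξ k ω = Set.indicator {ω | ξ k ω = 1} 1 ω := fun ω => by
      rcases hξ.values k ω with h0 | h0 <;> simp [Set.indicator, h0]
    rw [integral_congr_ae (Filter.Eventually.of_forall h1), integral_indicator_one, hξ.prob_one]
    exact hξ.measurable k (measurableSet_singleton 1)
  calc ∫ ω, ξ k ω * F (fun j => ξ (k + 1 + j) ω) ∂P
      = ∫ ω, φ (fun i : S => c (ξ i ω)) * ψ (fun i : T => c (ξ i ω)) ∂P := by
        simp_rw [hψξ, hφξ]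
    _ = (∫ ω, φ (fun i : S => c (ξ i ω)) ∂P) * ∫ ω, ψ (fun i : T => c (ξ i ω)) ∂P := hprod
    _ = _ := by simp_rw [hψξ, hφξ, hξint]

/-- The starting time `k` is arbitrary because removing the first step shifts the channel by one;
identical distribution makes the value independent of `k`. -/
lemma IsErasureChannel.integral_norm_observerError_sq [IsProbabilityMeasure P]
    (hξ : IsErasureChannel P p ξ) (f : E N → E N) (h : E N → E M) (K : E M → E N)
    (t k : ℕ) (x z : E N) :
    ∫ ω, ‖observerError f h K (fun j => ξ (k + j) ω) x z t‖ ^ 2 ∂P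
      = meanSqError p f h K t x z := by
  induction t generalizing k x z with
  | zero => simp [observerError, observerState, meanSqError]
  | succ t ih =>
    let F : ℝ → (ℕ → ℝ) → ℝ := fun a s =>
      ‖observerError f h K s (f x) (observerStep f h K a x z) t‖ ^ 2
    have hF : ∀ a, ∀ s s' : ℕ → ℝ, (∀ j < t, s j = s' j) → F a s = F a s' := fun a s s' hs => by
      simp only [F, observerError, observerState_congr f h K (f x) _ hs]
    obtain ⟨hi0, he0⟩ := hξ.integral_mul_eq k t (F 0) (hF 0)
    obtain ⟨hi1, he1⟩ := hξ.integral_mul_eq k t (F 1) (hF 1)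
    have hmul : ∀ {G : Ω → ℝ}, Integrable G P → Integrable (fun ω => ξ k ω * G ω) P := fun hG =>
      hG.bdd_mul (c := 1) (hξ.measurable k).aestronglyMeasurable
        (Filter.Eventually.of_forall fun ω => by
          rcases hξ.values k ω with h0 | h0 <;> simp [h0])
    -- As `ξ k` is `0` or `1`, the squared error is `(1 - ξ k) F 0 + ξ k F 1`.
    have hpt : ∀ ω, ‖observerError f h K (fun j => ξ (k + j) ω) x z (t + 1)‖ ^ 2
        = F 0 (fun j => ξ (k + 1 + j) ω) - ξ k ω * F 0 (fun j => ξ (k + 1 + j) ω)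
          + ξ k ω * F 1 (fun j => ξ (k + 1 + j) ω) := fun ω => by
      have hj : (fun j => ξ (k + (j + 1)) ω) = fun j => ξ (k + 1 + j) ω := by
        funext j; rw [add_assoc, add_comm 1 j]
      rw [observerError_succ', hj]
      rcases hξ.values k ω with h0 | h0 <;> simp [F, h0]
    have hadd := integral_add (hi0.sub (hmul hi0)) (hmul hi1)
    simp only [Pi.sub_apply] at hadd
    simp_rw [hpt]
    rw [hadd, integral_sub hi0 (hmul hi0), he0, he1,
      meanSqError, ← ih (k + 1), ← ih (k + 1)]
    ring

end Channel

/-! ### Passage from the nonlinear error to its linearization -/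

section Linearization

lemma jac_mulVec {ι κ : Type*} [Fintype ι] [DecidableEq ι] [Fintype κ]
    (F : EuclideanSpace ℝ ι → EuclideanSpace ℝ κ) (x v : EuclideanSpace ℝ ι) :
    jac F x *ᵥ v.ofLp = (fderiv ℝ F x v).ofLp := by
  ext i
  conv_rhs => rw [← (EuclideanSpace.basisFun ι ℝ).sum_repr v]
  simp [jac, mulVec, dotProduct, mul_comm]

lemma continuousAt_jac {ι κ : Type*} [Fintype ι] [DecidableEq ι] [Fintype κ]
    {F : EuclideanSpace ℝ ι → EuclideanSpace ℝ κ} {x : EuclideanSpace ℝ ι}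
    (hF : ContDiffAt ℝ 1 F x) : ContinuousAt (jac F) x := by
  have h : ContinuousAt (fderiv ℝ F) x := (hF.fderiv_right (m := 0) (by simp)).continuousAt
  refine continuousAt_pi.2 fun i => continuousAt_pi.2 fun j => ?_
  have h1 : ContinuousAt (fun y => fderiv ℝ F y (EuclideanSpace.single j 1)) x :=
    h.clm_apply continuousAt_const
  exact (EuclideanSpace.proj (𝕜 := ℝ) i).continuous.continuousAt.comp h1

lemma continuousAt_matrix_mul {α l m n : Type*} [TopologicalSpace α] [Fintype m]
    {S : α → Matrix l m ℝ} {T : α → Matrix m n ℝ} {x : α} (hS : ContinuousAt S x)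
    (hT : ContinuousAt T x) : ContinuousAt (fun y => S y * T y) x :=
  ContinuousAt.comp (g := fun q : Matrix l m ℝ × Matrix m n ℝ => q.1 * q.2)
    (continuous_fst.matrix_mul continuous_snd).continuousAt (hS.prodMk hT)

lemma continuousAt_secondMoment {α ι : Type*} [TopologicalSpace α] [Fintype ι] [DecidableEq ι]
    (p : ℝ) {X : Set α} {f : α → α} (hf : Set.MapsTo f X X) (hfc : ∀ x ∈ X, ContinuousAt f x)
    {A D : α → Matrix ι ι ℝ} (hA : ∀ x ∈ X, ContinuousAt A x) (hD : ∀ x ∈ X, ContinuousAt D x)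
    (t : ℕ) : ∀ x ∈ X, ContinuousAt (secondMoment p f A D t) x := by
  induction t with
  | zero => exact fun x _ => continuousAt_const
  | succ t ih =>
    intro x hx
    have h1 : ContinuousAt (fun y => secondMoment p f A D t (f y)) x :=
      ContinuousAt.comp (ih (f x) (hf hx)) (hfc x hx)
    have hmul : ∀ {B : α → Matrix ι ι ℝ}, ContinuousAt B x →
        ContinuousAt (fun y => (B y)ᵀ * secondMoment p f A D t (f y) * B y) x := fun hB =>
      continuousAt_matrix_mul (continuousAt_matrix_mul
        (continuous_id.matrix_transpose.continuousAt.comp hB) h1) hB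
    exact ((hmul (hA x hx)).const_smul (1 - p)).add ((hmul (hD x hx)).const_smul p)

variable {N M : ℕ}

/-- The Jacobian of the error dynamics when the output is received. -/
noncomputable def closedLoopJac (f : E N → E N) (h : E N → E M) (K : E M → E N) (x : E N) :
    Matrix (Fin N) (Fin N) ℝ :=
  jac f x - jac K (h x) * jac h x

/-- The points `z n` need not lie on a ray: they are images under earlier steps, and initially must
avoid a null set. -/
lemma tendsto_difference_quotient {G : E N → E N} {G' : E N →L[ℝ] E N} {x : E N}
    (hG : HasFDerivAt G G' x) {z : ℕ → E N} {ε : ℕ → ℝ} (hε : ∀ n, 0 < ε n)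
    (hε0 : Filter.Tendsto ε Filter.atTop (nhds 0)) {v : E N}
    (hz : Filter.Tendsto (fun n => (ε n)⁻¹ • (x - z n)) Filter.atTop (nhds v)) :
    Filter.Tendsto (fun n => (ε n)⁻¹ • (G x - G (z n))) Filter.atTop (nhds (G' v)) := by
  have hz' : Filter.Tendsto (fun n => (ε n)⁻¹ • (z n - x)) Filter.atTop (nhds (-v)) :=
    hz.neg.congr fun n => by rw [← smul_neg, neg_sub]
  have hd : Filter.Tendsto (fun n => z n - x) Filter.atTop (nhds 0) := by
    have := hε0.smul hz'
    rw [zero_smul] at this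
    exact this.congr fun n => smul_inv_smul₀ (hε n).ne' _
  have := (hG.hasFDerivWithinAt.lim hd (Filter.Eventually.of_forall fun _ => Set.mem_univ _)
    hz').neg
  rw [map_neg, neg_neg] at this
  refine this.congr fun n => ?_
  rw [← smul_neg, neg_sub, add_sub_cancel]

/-- Either branch maps a convergent difference quotient to one converging to the image of `v` under
that branch's Jacobian, so the limit obeys the recursion of the second moments. -/
lemma tendsto_meanSqError (p : ℝ) {X : Set (E N)} {f : E N → E N} {h : E N → E M}
    {K : E M → E N} (hf : Set.MapsTo f X X) (hfd : ∀ x ∈ X, DifferentiableAt ℝ f x)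
    (hhd : ∀ x ∈ X, DifferentiableAt ℝ h x) (hKd : ∀ x ∈ X, DifferentiableAt ℝ K (h x))
    {ε : ℕ → ℝ} (hε : ∀ n, 0 < ε n) (hε0 : Filter.Tendsto ε Filter.atTop (nhds 0)) (t : ℕ) :
    ∀ x ∈ X, ∀ (z : ℕ → E N) (v : E N),
      Filter.Tendsto (fun n => (ε n)⁻¹ • (x - z n)) Filter.atTop (nhds v) →
      Filter.Tendsto (fun n => meanSqError p f h K t x (z n) / ε n ^ 2) Filter.atTop
        (nhds (v.ofLp ⬝ᵥ secondMoment p f (jac f) (closedLoopJac f h K) t x *ᵥ v.ofLp)) := by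
  induction t with
  | zero =>
    intro x _ z v hz
    have h2 := hz.norm.pow 2
    have hv : ‖v‖ ^ 2 = v.ofLp ⬝ᵥ v.ofLp := by
      rw [← real_inner_self_eq_norm_sq, EuclideanSpace.inner_eq_star_dotProduct, star_trivial]
    rw [secondMoment, one_mulVec, ← hv]
    refine h2.congr fun n => ?_
    rw [norm_smul, meanSqError, norm_inv, Real.norm_eq_abs, abs_of_pos (hε n), mul_pow, inv_pow,
      inv_mul_eq_div]
  | succ t ih =>
    intro x hx z v hz
    have h0 : HasFDerivAt (observerStep f h K 0 x) (fderiv ℝ f x) x := by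
      have : observerStep f h K 0 x = f := by funext y; simp [observerStep]
      rw [this]; exact (hfd x hx).hasFDerivAt
    have h1 : HasFDerivAt (observerStep f h K 1 x)
        (fderiv ℝ f x - (fderiv ℝ K (h x)).comp (fderiv ℝ h x)) x := by
      have : observerStep f h K 1 x = fun y => f y + K (h x) - (K ∘ h) y := by
        funext y; simp [observerStep]
      rw [this]
      exact ((hfd x hx).hasFDerivAt.add_const _).sub
        ((hKd x hx).hasFDerivAt.comp x (hhd x hx).hasFDerivAt)
    -- An observer at the true state follows the plant, so difference quotients of the observer step
    -- at `x` are rescaled errors.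
    have hfix : ∀ s, observerStep f h K s x x = f x := fun s => by simp [observerStep]
    have e0 := tendsto_difference_quotient h0 hε hε0 hz
    have e1 := tendsto_difference_quotient h1 hε hε0 hz
    rw [hfix] at e0 e1
    have l0 := (ih (f x) (hf hx) _ _ e0).const_mul (1 - p)
    have l1 := (ih (f x) (hf hx) _ _ e1).const_mul p
    have hD : closedLoopJac f h K x *ᵥ v.ofLp
        = ((fderiv ℝ f x - (fderiv ℝ K (h x)).comp (fderiv ℝ h x)) v).ofLp := by
      simp [closedLoopJac, sub_mulVec, ← mulVec_mulVec, jac_mulVec]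
    rw [dotProduct_secondMoment_succ, jac_mulVec, hD]
    refine (l0.add l1).congr fun n => ?_
    rw [meanSqError]
    ring

/-- Mean-square exponential stability of the error passes to the linearization, at every state. -/
lemma dotProduct_secondMoment_le {p L β : ℝ} {X : Set (E N)} (hX : X ⊆ closure (interior X))
    {f : E N → E N} {h : E N → E M} {K : E M → E N} (hf : Set.MapsTo f X X)
    (hfd : ∀ x ∈ X, ContDiffAt ℝ 1 f x) (hhd : ∀ x ∈ X, ContDiffAt ℝ 1 h x)
    (hKd : ∀ x ∈ X, ContDiffAt ℝ 1 K (h x))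
    (hst : ∀ᵐ x : E N, x ∈ X → ∀ᵐ z : E N, z ∈ X → ∀ t : ℕ,
      meanSqError p f h K (t + 1) x z ≤ L * β ^ t * ‖x - z‖ ^ 2) :
    ∀ x ∈ X, ∀ (t : ℕ) (v : Fin N → ℝ),
      v ⬝ᵥ secondMoment p f (jac f) (closedLoopJac f h K) (t + 1) x *ᵥ v
        ≤ L * β ^ t * (v ⬝ᵥ v) := by
  have hfd' : ∀ x ∈ X, DifferentiableAt ℝ f x := fun x hx => (hfd x hx).differentiableAt (by simp)
  have hhd' : ∀ x ∈ X, DifferentiableAt ℝ h x := fun x hx => (hhd x hx).differentiableAt (by simp)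
  have hKd' : ∀ x ∈ X, DifferentiableAt ℝ K (h x) :=
    fun x hx => (hKd x hx).differentiableAt (by simp)
  set ε : ℕ → ℝ := fun n => 1 / ((n : ℝ) + 1) with hεdef
  have hε : ∀ n, 0 < ε n := fun n => Nat.one_div_pos_of_nat
  have hε0 : Filter.Tendsto ε Filter.atTop (nhds 0) := tendsto_one_div_add_atTop_nhds_zero_nat
  have hinterior : ∀ x ∈ interior X, (∀ᵐ z : E N, z ∈ X → ∀ t : ℕ,
      meanSqError p f h K (t + 1) x z ≤ L * β ^ t * ‖x - z‖ ^ 2) → ∀ (t : ℕ) (v : Fin N → ℝ),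
      v ⬝ᵥ secondMoment p f (jac f) (closedLoopJac f h K) (t + 1) x *ᵥ v
        ≤ L * β ^ t * (v ⬝ᵥ v) := by
    intro x hx hae t v'
    obtain ⟨v, rfl⟩ : ∃ v : E N, v.ofLp = v' := ⟨WithLp.toLp 2 v', rfl⟩
    have hdense := Measure.dense_of_ae hae
    -- Good initial states are conull, hence dense. Taking them within `ε²` of `x - ε v` keeps the
    -- quotient within `ε` of `v`; interiority of `x` puts them eventually in `X`.
    choose z hzG hzd using fun n =>
      hdense.exists_dist_lt (x - ε n • v) (pow_pos (hε n) 2)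
    have hlim : Filter.Tendsto (fun n => (ε n)⁻¹ • (x - z n)) Filter.atTop (nhds v) := by
      rw [tendsto_iff_norm_sub_tendsto_zero]
      refine squeeze_zero (fun n => norm_nonneg _) (fun n => ?_) hε0
      have e : (ε n)⁻¹ • (x - z n) - v = (ε n)⁻¹ • (x - ε n • v - z n) := by
        rw [sub_right_comm, smul_sub _ (x - z n), inv_smul_smul₀ (hε n).ne']
      rw [e, norm_smul, norm_inv, Real.norm_eq_abs, abs_of_pos (hε n), ← dist_eq_norm,
        inv_mul_le_iff₀ (hε n), ← sq]
      exact (hzd n).le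
    have hzx : Filter.Tendsto z Filter.atTop (nhds x) := by
      have := (hε0.smul hlim).const_sub x
      rw [zero_smul, sub_zero] at this
      refine this.congr fun n => ?_
      rw [smul_inv_smul₀ (hε n).ne', sub_sub_cancel]
    have hL := tendsto_meanSqError p hf hfd' hhd' hKd' hε hε0 (t + 1) x (interior_subset hx) z v
      hlim
    have hR := tendsto_meanSqError p hf hfd' hhd' hKd' hε hε0 0 x (interior_subset hx) z v hlim
    rw [secondMoment, one_mulVec] at hR
    refine le_of_tendsto_of_tendsto hL (hR.const_mul (L * β ^ t)) ?_
    filter_upwards [hzx.eventually (isOpen_interior.mem_nhds hx)] with n hn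
    rw [meanSqError, ← mul_div_assoc]
    exact div_le_div_of_nonneg_right (hzG n (interior_subset hn) t) (sq_nonneg _)
  intro x hx t v
  have hcont : ContinuousAt (fun y => v ⬝ᵥ
      secondMoment p f (jac f) (closedLoopJac f h K) (t + 1) y *ᵥ v) x := by
    have h1 := continuousAt_secondMoment p hf (fun x hx => (hfd' x hx).continuousAt)
      (fun x hx => continuousAt_jac (hfd x hx)) (D := closedLoopJac f h K)
      (fun x hx => (continuousAt_jac (hfd x hx)).sub
        (continuousAt_matrix_mul ((continuousAt_jac (hKd x hx)).comp (hhd' x hx).continuousAt)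
          (continuousAt_jac (hhd x hx)))) (t + 1) x hx
    exact ContinuousAt.comp (g := fun S : Matrix (Fin N) (Fin N) ℝ => v ⬝ᵥ S *ᵥ v)
      (by fun_prop) h1
  -- Good plant states are dense in the interior, whose closure contains `X`; continuity then
  -- extends the bound to `x`.
  have hmem : x ∈ closure (interior X ∩ _) :=
    closure_minimal ((Measure.dense_of_ae hst).open_subset_closure_inter isOpen_interior)
      isClosed_closure (hX hx)
  exact le_of_tendsto_of_frequently hcont.tendsto <|
    (mem_closure_iff_frequently.1 hmem).mono fun y hy =>
      hinterior y hy.1 (hy.2 (interior_subset hy.1)) t v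

end Linearization

/-! ### From the Lyapunov solution to the Riccati equation -/

lemma inv_smul_one {ι : Type*} [Fintype ι] [DecidableEq ι] {c : ℝ} (hc : c ≠ 0) :
    (c • (1 : Matrix ι ι ℝ))⁻¹ = c⁻¹ • (1 : Matrix ι ι ℝ) :=
  inv_eq_right_inv (by simp [smul_smul, hc])

/-- A bounded Lyapunov solution that dominates its open-loop congruence up to output injection
gives, after scaling and inversion, a bounded solution of the Riccati equation with positive
semidefinite `R`. -/
lemma exists_riccati_of_lyapunov {N M : ℕ} {X : Set (E N)} {f : E N → E N} {h : E N → E M}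
    (hf : Set.MapsTo f X X) {P : E N → Matrix (Fin N) (Fin N) ℝ} {γ k : ℝ} (hγ : 0 < γ)
    (hk : 0 < k) (hP : ∀ x ∈ X, (P x).IsHermitian) (hlb : ∀ x ∈ X, ∀ v, v ⬝ᵥ v ≤ v ⬝ᵥ P x *ᵥ v)
    (hub : ∀ x ∈ X, ∀ v, v ⬝ᵥ P x *ᵥ v ≤ γ * (v ⬝ᵥ v))
    (hdom : ∀ x ∈ X, ∀ v, (jac f x *ᵥ v) ⬝ᵥ P (f x) *ᵥ (jac f x *ᵥ v)
      ≤ v ⬝ᵥ P x *ᵥ v + k * ((jac h x *ᵥ v) ⬝ᵥ (jac h x *ᵥ v))) :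
    ∃ R : E N → Matrix (Fin N) (Fin N) ℝ, UniformlyBounded X (fun x => (k⁻¹ • P x)⁻¹) ∧
      (∀ x ∈ X, (R x).PosSemidef) ∧ SolvesRiccati X f h (fun x => (k⁻¹ • P x)⁻¹) R := by
  have hc : 0 < k⁻¹ := inv_pos.2 hk
  have hSh : ∀ x ∈ X, (k⁻¹ • P x).IsHermitian := fun x hx => by
    rw [IsHermitian, conjTranspose_smul, hP x hx, star_trivial]
  have hSv : ∀ x v, v ⬝ᵥ (k⁻¹ • P x) *ᵥ v = k⁻¹ * (v ⬝ᵥ P x *ᵥ v) := fun x v => by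
    rw [smul_mulVec, dotProduct_smul, smul_eq_mul]
  have hSl : ∀ x ∈ X, (k⁻¹ • P x - k⁻¹ • (1 : Matrix (Fin N) (Fin N) ℝ)).PosSemidef :=
    fun x hx => (posSemidef_sub_iff (isHermitian_smul_one _) (hSh x hx)).2 fun v => by
      rw [dotProduct_smul_one_mulVec, hSv]
      exact mul_le_mul_of_nonneg_left (hlb x hx v) hc.le
  have hSu : ∀ x ∈ X, ((k⁻¹ * γ) • (1 : Matrix (Fin N) (Fin N) ℝ) - k⁻¹ • P x).PosSemidef :=
    fun x hx => (posSemidef_sub_iff (hSh x hx) (isHermitian_smul_one _)).2 fun v => by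
      rw [dotProduct_smul_one_mulVec, hSv, mul_assoc]
      exact mul_le_mul_of_nonneg_left (hub x hx v) hc.le
  have hS : ∀ x ∈ X, (k⁻¹ • P x).PosDef := fun x hx =>
    posDef_of_posSemidef_sub_smul_one hc (hSl x hx)
  have hCC : ∀ x, ((jac h x)ᵀ * jac h x).PosSemidef := fun x => by
    simpa using posSemidef_conjTranspose_mul_self (jac h x)
  -- `R` is `Q (f x)` minus the Riccati update in information form, so the equation holds by
  -- construction and only `R ≥ 0` needs the domination hypothesis.
  refine ⟨fun x => (k⁻¹ • P (f x))⁻¹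
      - jac f x * (k⁻¹ • P x + (jac h x)ᵀ * jac h x)⁻¹ * (jac f x)ᵀ,
    ⟨(k⁻¹ * γ)⁻¹, k⁻¹⁻¹, by positivity, by positivity, fun x hx => ⟨?_, ?_⟩⟩, fun x hx => ?_,
    fun x hx => ?_⟩
  · have hpos : 0 < k⁻¹ * γ := by positivity
    have := posSemidef_inv_sub (hS x hx) (PosDef.one.smul hpos) 1
      (by rw [transpose_one, Matrix.one_mul, Matrix.mul_one]; exact hSu x hx)
    simpa only [Matrix.one_mul, transpose_one, Matrix.mul_one, inv_smul_one hpos.ne'] using this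
  · have := posSemidef_inv_sub (PosDef.one.smul hc) (hS x hx) 1
      (by rw [transpose_one, Matrix.one_mul, Matrix.mul_one]; exact hSl x hx)
    simpa only [Matrix.one_mul, transpose_one, Matrix.mul_one, inv_smul_one hc.ne'] using this
  · have hW := (hS x hx).add_posSemidef (hCC x)
    refine posSemidef_inv_sub (hS _ (hf hx)) hW _ ?_
    refine (posSemidef_sub_iff (isHermitian_transpose_mul_mul (hSh _ (hf hx)) _)
      hW.isHermitian).2 fun v => ?_
    rw [dotProduct_mulVec_transpose_mul_mul, add_mulVec, dotProduct_add,
      dotProduct_mulVec_transpose_mul, hSv, hSv]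
    -- Scaling by `k⁻¹` turns `k Cᵀ C` into `Cᵀ C`, the information term of the Riccati update.
    refine (mul_le_mul_of_nonneg_left (hdom x hx v) hc.le).trans_eq ?_
    rw [mul_add, inv_mul_cancel_left₀ hk.ne']
  · have := riccati_eq_information (hS x hx) (jac f x) (jac h x)
    beta_reduce
    rw [add_sub_right_comm, this, add_sub_cancel]

end ErasureObserver

/-! ### Assembly of the main theorem -/

theorem mainTheorem4 {N M : ℕ} (hMN : M < N)
    {Ω : Type*} [MeasurableSpace Ω] (P : Measure Ω) [IsProbabilityMeasure P]
    (p : ℝ) (hp0 : 0 < p) (hp1 : p < 1)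
    (ξ : ℕ → Ω → ℝ) (hξ : ErasureObserver.IsErasureChannel P p ξ)
    (r : WithTop ℕ∞) (hr : 1 ≤ r)
    (X : Set (ErasureObserver.E N)) (hX : X ⊆ closure (interior X))
    (Y : Set (ErasureObserver.E M))
    (f : ErasureObserver.E N → ErasureObserver.E N)
    (h : ErasureObserver.E N → ErasureObserver.E M) (hY : Set.MapsTo h X Y)
    (hfh : ErasureObserver.IsRegularObservable r X f h)
    (hrow : ∃ δ : ℝ, 0 < δ ∧ ∀ x ∈ X,
      (ErasureObserver.jac h x * (ErasureObserver.jac h x)ᵀ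
        - δ • (1 : Matrix (Fin M) (Fin M) ℝ)).PosSemidef)
    (K : ErasureObserver.E M → ErasureObserver.E N)
    (hK : ErasureObserver.IsObserverGain r X Y f h K)
    (hstable : ErasureObserver.ErrorMSEStable P ξ X f h K) :
    ∃ Q R : ErasureObserver.E N → Matrix (Fin N) (Fin N) ℝ,
      ErasureObserver.UniformlyBounded X Q ∧
      (∀ x ∈ X, (R x).PosSemidef) ∧
      ErasureObserver.SolvesRiccati X f h Q R ∧
      ∀ᵐ x : ErasureObserver.E N, x ∈ X →
        (1 - p) ^ M * (ErasureObserver.jac f x).det ^ 2 * ((Q x).det / (Q (f x)).det) < 1 := by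
  open ErasureObserver in
  have hf := hfh.mapsTo
  obtain ⟨L, β, hL, hβ0, hβ1, hst⟩ := hstable
  obtain ⟨δ, hδ, hC⟩ := hrow
  obtain ⟨a, b, ha, hb, hab⟩ := hfh.jac_bounds
  have : Nonempty (Fin N) := ⟨⟨M, hMN⟩⟩
  have hdecay := dotProduct_secondMoment_le (p := p) hX hf
    (fun x hx => (hfh.contDiff_f x hx).of_le hr) (fun x hx => (hfh.contDiff_h x hx).of_le hr)
    (fun x hx => (hK.contDiff _ (hY hx)).of_le hr) <| by
      filter_upwards [hst] with x hx hxX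
      filter_upwards [hx hxX] with z hz hzX t
      have := hξ.integral_norm_observerError_sq f h K (t + 1) 0 x z
      simp only [zero_add] at this
      rw [← this]
      exact hz hzX t
  obtain ⟨G, γ, hγ, hG⟩ := exists_lyapunov hp0.le hp1.le hL hβ0 hβ1 hf hdecay
  obtain ⟨k, hk, hdom⟩ := exists_le_add_mul_output (ι := Fin N) (κ := Fin M) hp0 hL hb hδ hγ
  have hself : ∀ u : Fin N → ℝ, 0 ≤ u ⬝ᵥ u := fun u => by
    simpa using dotProduct_star_self_nonneg u
  have hAA : ∀ x, (jac f x)ᵀ * jac f x = (jac f x)ᵀ * 1 * jac f x := fun x => by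
    rw [Matrix.mul_one]
  have hAAh : ∀ x, ((jac f x)ᵀ * jac f x).IsHermitian := fun x => by
    rw [hAA]; exact isHermitian_transpose_mul_mul isHermitian_one _
  have hD : ∀ x v, jac h x *ᵥ v = 0 → closedLoopJac f h K x *ᵥ v = jac f x *ᵥ v :=
    fun x v hv => by
      rw [closedLoopJac, sub_mulVec, ← mulVec_mulVec, hv, mulVec_zero, sub_zero]
  have hnn : ∀ x ∈ X, ∀ v, 0 ≤ v ⬝ᵥ G x *ᵥ v := fun x hx v =>
    (hself v).trans ((hG x hx).2.1 v)
  obtain ⟨R, hQ, hR, hric⟩ := exists_riccati_of_lyapunov (h := h) hf hγ hk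
    (fun x hx => (hG x hx).1) (fun x hx => (hG x hx).2.1) (fun x hx => (hG x hx).2.2.1)
    fun x hx => hdom (G x) (G (f x)) (jac f x) (closedLoopJac f h K x) (jac h x)
      (hG _ (hf hx)).1 (hnn _ (hf hx)) (hG _ (hf hx)).2.2.1
      (fun v => by
        have := (posSemidef_sub_iff (hAAh x) (isHermitian_smul_one b)).1 (hab x hx).2 v
        rwa [dotProduct_mulVec_transpose_mul, dotProduct_smul_one_mulVec] at this)
      (fun v => by
        -- The gain's Jacobian has no assumed uniform bound; one-step decay gives `p |D v|² ≤ L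
        -- |v|²`.
        have h0 := hdecay x hx 0 v
        rw [dotProduct_secondMoment_succ, secondMoment, one_mulVec, one_mulVec,
          pow_zero, mul_one] at h0
        have := mul_nonneg (sub_nonneg.2 hp1.le) (hself (jac f x *ᵥ v))
        linarith)
      (hD x) (hC x hx) (fun v => ((hG x hx).2.2.2 v).ge)
  refine ⟨_, R, hQ, hR, hric, Filter.Eventually.of_forall fun x hx => ?_⟩
  have hpd : ∀ y ∈ X, (G y).PosDef := fun y hy =>
    posDef_of_posSemidef_sub_smul_one one_pos <|
      (posSemidef_sub_iff (isHermitian_smul_one 1) (hG y hy).1).2 fun v => by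
        rw [dotProduct_smul_one_mulVec, one_mul]; exact (hG y hy).2.1 v
  have hA0 : (jac f x).det ≠ 0 := fun h0 => by
    have := (posDef_of_posSemidef_sub_smul_one ha (hab x hx).1).det_pos
    simp [h0] at this
  have hdet := pow_mul_det_lt_det hp0 hp1 (hG x hx).1 (hpd _ (hf hx)) hA0 (hD x) fun v hv => by
    have hv0 : 0 < v ⬝ᵥ v := by simpa using dotProduct_star_self_pos_iff.2 hv
    have := (hG x hx).2.2.2 v
    linarith
  have h0 := (hpd x hx).det_pos
  have h1 := (hpd _ (hf hx)).det_pos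
  -- The scale `k` cancels in the ratio, and inversion turns it into `det G(f x) / det G(x)`.
  rw [det_nonsing_inv, det_nonsing_inv, Ring.inverse_eq_inv', det_smul, det_smul]
  calc (1 - p) ^ M * (jac f x).det ^ 2
        * ((k⁻¹ ^ Fintype.card (Fin N) * (G x).det)⁻¹
          / (k⁻¹ ^ Fintype.card (Fin N) * (G (f x)).det)⁻¹)
      = (1 - p) ^ M * (jac f x).det ^ 2 * (G (f x)).det / (G x).det := by field_simp
    _ < 1 := (div_lt_one h0).2 hdet
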